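/- Let $E$ be a finite-dimensional real inner product space and let $W$ be a finite Coxeter group acting on $E$, i.e. a finite subgroup of the orthogonal group $O(E)$ generated by orthogonal reflections in hyperplanes through the origin. Let $\Phi$ be the set of all unit vectors $\alpha\in E$ such that the reflection in the hyperplane $\alpha^{\perp}$ belongs to $W$, and let $$Z=\Bigl\{\sum_{\alpha\in\Phi}c_\alpha\alpha \;:\; 0\le c_\alpha\le 1\Bigr\}$$ be the zonotope generated by $\Phi$. (No assumption is made that $\Phi$ spans $E$; dimensions and codimensions of polytopes are taken relative to their affine spans.) A $d$-dimensional polytope is called simple if each of its vertices lies on exactly $d$ edges. A polytope $P$ is called non-acute in codimension $1$ (resp. obtuse in codimension $1$) if, at every face of $P$ of codimension $2$, the dihedral angle between the two facets (codimension $1$ faces) of $P$ meeting there is at least $\pi/2$ (resp. greater than $\pi/2$). A polytope $P$ is called non-acute if $P$ and all of its nonempty faces, considered as polytopes in their own right, are non-acute in codimension $1$. The group $W$ is called irreducible if it is nontrivial and is not the internal direct product of two nontrivial subgroups that are each generated by reflections. Then: 1. $Z$ is a simple polytope. 2. $Z$ is non-acute. 3. If $W$ is irreducible, then $Z$ is obtuse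 in codimension $1$. -/

import Mathlib

namespace CoxeterZonotope

/-! ### Convex polytopes in a Euclidean space -/

section Polytopes

variable {E : Type*} [NormedAddCommGroup E] [InnerProductSpace ℝ E]

/-- A polytope is the convex hull of a finite set of points. -/
def IsPolytope (P : Set E) : Prop :=
  ∃ S : Finset E, P = convexHull ℝ (S : Set E)

/-- The dimension of the affine span. -/
noncomputable def dim (P : Set E) : ℕ :=
  Module.finrank ℝ (vectorSpan ℝ P)

/-- The nonempty faces of `P`: the sets of maximizers over `P` of a linear functional.
The zero functional gives `P` itself. -/
def IsFace (P F : Set E) : Prop :=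
  F.Nonempty ∧ IsExposed ℝ P F

/-- A `d`-dimensional polytope is simple if every vertex lies on exactly `d` edges. -/
def IsSimple (P : Set E) : Prop :=
  IsPolytope P ∧
    ∀ v : E, IsFace P {v} →
      Set.encard {F : Set E | IsFace P F ∧ dim F = 1 ∧ v ∈ F} = (dim P : ℕ∞)

/-- For a face `G` of codimension one in `F`: `u` is the unit vector parallel to `F`,
perpendicular to `G`, and pointing from `G` into `F`. -/
def IsInwardUnitNormal (G F : Set E) (u : E) : Prop :=
  ‖u‖ = 1 ∧ u ∈ vectorSpan ℝ F ∧ u ∈ (vectorSpan ℝ G)ᗮ ∧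
    ∀ x ∈ G, ∀ y ∈ F, 0 ≤ inner ℝ u (y - x)

/-- `θ` is the dihedral angle along `G` between `F₁` and `F₂`, where `G` has codimension one
in both: the angle between the perpendiculars to `G` pointing into `F₁` and into `F₂`. -/
def HasDihedralAngle (G F₁ F₂ : Set E) (θ : ℝ) : Prop :=
  ∃ u₁ u₂ : E, IsInwardUnitNormal G F₁ u₁ ∧ IsInwardUnitNormal G F₂ u₂ ∧
    θ = InnerProductGeometry.angle u₁ u₂

/-- `G` is a codimension two face of `P`, and `F₁`, `F₂` are the two facets meeting there. -/
def FacetsMeetAt (P G F₁ F₂ : Set E) : Prop :=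
  IsFace P G ∧ dim G + 2 = dim P ∧
    (IsFace P F₁ ∧ dim F₁ + 1 = dim P ∧ G ⊆ F₁) ∧
    (IsFace P F₂ ∧ dim F₂ + 1 = dim P ∧ G ⊆ F₂) ∧ F₁ ≠ F₂

/-- All dihedral angles of `P` at codimension two faces are at least `π / 2`. -/
def NonAcuteInCodimOne (P : Set E) : Prop :=
  ∀ G F₁ F₂ : Set E, FacetsMeetAt P G F₁ F₂ →
    ∃ θ : ℝ, HasDihedralAngle G F₁ F₂ θ ∧ Real.pi / 2 ≤ θ

/-- All dihedral angles of `P` at codimension two faces are greater than `π / 2`. -/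
def ObtuseInCodimOne (P : Set E) : Prop :=
  ∀ G F₁ F₂ : Set E, FacetsMeetAt P G F₁ F₂ →
    ∃ θ : ℝ, HasDihedralAngle G F₁ F₂ θ ∧ Real.pi / 2 < θ

/-- `P` and all its faces, as polytopes in their own right, are non-acute in codimension one. -/
def NonAcute (P : Set E) : Prop :=
  ∀ F : Set E, IsFace P F → NonAcuteInCodimOne F

/-- The zonotope generated by a finite set of vectors. -/
def zonotope (A : Finset E) : Set E :=
  {z | ∃ c : E → ℝ, (∀ α ∈ A, 0 ≤ c α ∧ c α ≤ 1) ∧ z = ∑ α ∈ A, c α • α}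

end Polytopes

/-! ### Finite reflection groups and their zonotopes -/

section ReflectionGroups

variable {E : Type*} [NormedAddCommGroup E] [InnerProductSpace ℝ E]

/-- The orthogonal reflection in the hyperplane perpendicular to `α` (when `α ≠ 0`). -/
noncomputable def hyperplaneReflection (α : E) : E ≃ₗᵢ[ℝ] E :=
  (Submodule.span ℝ {α})ᗮ.reflection

/-- `s` is a reflection in a hyperplane. -/
def IsHyperplaneReflection (s : E ≃ₗᵢ[ℝ] E) : Prop :=
  ∃ α : E, α ≠ 0 ∧ s = hyperplaneReflection α

/-- `W` is generated by the reflections it contains. -/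
def GeneratedByReflections (W : Subgroup (E ≃ₗᵢ[ℝ] E)) : Prop :=
  Subgroup.closure {s : E ≃ₗᵢ[ℝ] E | s ∈ W ∧ IsHyperplaneReflection s} = W

/-- `W` is nontrivial and is not the internal direct product of two nontrivial subgroups
generated by reflections. -/
def IsIrreducible (W : Subgroup (E ≃ₗᵢ[ℝ] E)) : Prop :=
  W ≠ ⊥ ∧ ∀ W₁ W₂ : Subgroup (E ≃ₗᵢ[ℝ] E),
    GeneratedByReflections W₁ → GeneratedByReflections W₂ →
    (∀ a ∈ W₁, ∀ b ∈ W₂, a * b = b * a) → W₁ ⊓ W₂ = ⊥ → W₁ ⊔ W₂ = W →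
    W₁ = ⊥ ∨ W₂ = ⊥

/-- The unit normals of the reflecting hyperplanes of `W`. -/
def unitRoots (W : Subgroup (E ≃ₗᵢ[ℝ] E)) : Set E :=
  {α | ‖α‖ = 1 ∧ hyperplaneReflection α ∈ W}

theorem hyperplaneReflection_self (α : E) : hyperplaneReflection α α = -α := by
  simp [hyperplaneReflection, Submodule.reflection_orthogonal_apply,
    Submodule.reflection_mem_subspace_eq_self (Submodule.mem_span_singleton_self α)]

theorem hyperplaneReflection_apply (α v : E) (hα : ‖α‖ = 1) :
    hyperplaneReflection α v = v - (2 * inner ℝ α v) • α := by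
  rw [hyperplaneReflection, Submodule.reflection_orthogonal_apply,
    Submodule.reflection_singleton_apply]
  simp [hα, smul_smul, two_smul, add_smul, two_mul]

theorem unitRoots_finite (W : Subgroup (E ≃ₗᵢ[ℝ] E)) [Finite W] : (unitRoots W).Finite := by
  refine Set.Finite.of_finite_fibers hyperplaneReflection
    ((Set.toFinite (W : Set (E ≃ₗᵢ[ℝ] E))).subset ?_) ?_
  · rintro _ ⟨α, hα, rfl⟩
    exact hα.2
  · rintro _ ⟨α, hα, rfl⟩
    refine (Set.toFinite {α, -α}).subset ?_
    rintro β ⟨hβ, hαβ⟩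
    have h1 : hyperplaneReflection β α = -α := by
      rw [show hyperplaneReflection β = hyperplaneReflection α from hαβ]
      exact hyperplaneReflection_self α
    rw [hyperplaneReflection_apply β α hβ.1, sub_eq_iff_eq_add] at h1
    have h2 : α = (inner ℝ β α : ℝ) • β := by
      have h3 : (2 : ℝ) • α = (2 : ℝ) • ((inner ℝ β α : ℝ) • β) := by
        rw [smul_smul, two_smul]
        nth_rewrite 1 [h1]
        abel
      exact smul_right_injective E (two_ne_zero) h3
    have h4 : |(inner ℝ β α : ℝ)| = 1 := by
      have := congrArg norm h2
      rw [norm_smul, hα.1, hβ.1, mul_one] at this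
      exact this.symm
    rcases (abs_eq zero_le_one).1 h4 with h | h
    · left
      rw [h2, h, one_smul]
    · right
      rw [Set.mem_singleton_iff, h2, h]
      simp

/-- The zonotope generated by all unit roots of the finite reflection group `W`. -/
noncomputable def coxeterZonotope (W : Subgroup (E ≃ₗᵢ[ℝ] E)) [Finite W] : Set E :=
  zonotope (unitRoots_finite W).toFinset

end ReflectionGroups

end CoxeterZonotope

/-!
A face of the zonotope of `A` is the set where a functional `l` is maximal. It is a translate of the
zonotope of `{α ∈ A | l α = 0}` (`setOf_isMax_eq_maxFace`). If `A` is the set of unit roots of a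
reflection group, then the roots in the kernel of `l` again form a root system, so every face is
again a translated root zonotope, and for non-acuteness only codimension one has to be considered.

Every face contains a vertex `∑_{g α > 0} α`, where `g` is a functional without zeros on the roots
(`exists_apex_mem_maxFace`). The roots that are positive for `g` are the nonnegative combinations,
among the roots, of a simple system `Δ`: a linearly independent set of roots with pairwise
non-acute angles (`exists_isSimpleSystem`, `linearIndepOn_of_inner_nonpos`). The face of `l`
contains the vertex of `g` exactly when `l` is nonnegative on `Δ`, and the face then depends only on
`{γ ∈ Δ | l γ = 0}`, which is a basis of its direction. Thus the faces at the vertex correspond to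
the subsets of `Δ`; in particular the edges correspond to the elements of `Δ`, whose number is the
dimension of the zonotope. So the zonotope is simple.

The two facets at a codimension two face omit one simple root each, and their inward normals are
opposite to the parts of two simple roots `i`, `j` orthogonal to the set `S` of the other simple
roots. The orthogonal part of `j` is `j` plus a nonnegative combination of `S`
(`IsSimpleSystem.perpPart_eq_add_sum`, from `coeff_nonpos`), so its inner product with `i` is at
most `0`. If it is `0`, the support of the orthogonal part of `j` is orthogonal to all other simple
roots (`IsSimpleSystem.exists_split_of_inner_perpPart_eq_zero`). Then all roots split into two
orthogonal parts (`IsSimpleSystem.mem_span_or_mem_span`), and the reflection group is the direct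
product of the subgroups generated by the reflections of each part, hence is not irreducible
(`IsIrreducible.not_split`).
-/

namespace CoxeterZonotope

/-! ### Faces of zonotopes -/

section Zonotopes

open Pointwise

variable {E : Type*} [NormedAddCommGroup E] [InnerProductSpace ℝ E]

theorem zero_mem_zonotope (A : Finset E) : (0 : E) ∈ zonotope A :=
  ⟨0, by simp, by simp⟩

theorem sum_mem_zonotope {A B : Finset E} (h : B ⊆ A) : ∑ α ∈ B, α ∈ zonotope A := by
  classical
  refine ⟨fun α => if α ∈ B then 1 else 0, fun α _ => by dsimp only; split_ifs <;> simp, ?_⟩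
  simp only [ite_smul, one_smul, zero_smul]
  rw [← Finset.sum_filter, Finset.filter_mem_eq_inter, Finset.inter_eq_right.2 h]

theorem mem_zonotope_of_mem {A : Finset E} {α : E} (h : α ∈ A) : α ∈ zonotope A := by
  simpa using sum_mem_zonotope (Finset.singleton_subset_iff.2 h)

theorem zonotope_eq_sum_segment (A : Finset E) :
    zonotope A = ∑ α ∈ A, convexHull ℝ ({0, α} : Set E) := by
  ext z
  simp only [Set.mem_finsetSum, convexHull_pair, segment_eq_image, zero_add, smul_zero]
  constructor
  · rintro ⟨c, hc, rfl⟩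
    exact ⟨fun α => c α • α, fun {α} hα => ⟨c α, hc α hα, rfl⟩, rfl⟩
  · rintro ⟨f, hf, rfl⟩
    have h : ∀ α, ∃ r : ℝ, α ∈ A → (0 ≤ r ∧ r ≤ 1) ∧ r • α = f α := fun α => by
      by_cases hα : α ∈ A
      · obtain ⟨r, hr, h⟩ := hf hα
        exact ⟨r, fun _ => ⟨hr, h⟩⟩
      · exact ⟨0, fun h => absurd h hα⟩
    choose c hc using h
    exact ⟨c, fun α hα => (hc α hα).1, Finset.sum_congr rfl fun α hα => (hc α hα).2.symm⟩

theorem isPolytope_zonotope (A : Finset E) : IsPolytope (zonotope A) := by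
  have hfin : (∑ α ∈ A, ({0, α} : Set E)).Finite := by
    classical
    induction A using Finset.induction_on with
    | empty => simp
    | insert a s ha ih =>
      rw [Finset.sum_insert ha]
      exact (Set.toFinite _).add ih
  exact ⟨hfin.toFinset, by rw [zonotope_eq_sum_segment, ← convexHull_sum, hfin.coe_toFinset]⟩

theorem vectorSpan_vadd_zonotope (t : E) (A : Finset E) :
    vectorSpan ℝ (t +ᵥ zonotope A) = Submodule.span ℝ (A : Set E) := by
  rw [vectorSpan_vadd, vectorSpan_eq_span_vsub_set_right ℝ (zero_mem_zonotope A)]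
  simp only [vsub_eq_sub, sub_zero, Set.image_id']
  refine le_antisymm (Submodule.span_le.2 ?_)
    (Submodule.span_mono fun α hα => mem_zonotope_of_mem hα)
  rintro _ ⟨c, -, rfl⟩
  exact Submodule.sum_mem _ fun α hα => Submodule.smul_mem _ _ (Submodule.subset_span hα)

/-- The translation vector of the face of `t +ᵥ zonotope A` on which `l` is maximal. When `l`
does not vanish on `A`, that face is a vertex, and this is the vertex. -/
noncomputable def apex (t : E) (A : Finset E) (l : StrongDual ℝ E) : E :=
  t + ∑ α ∈ A with 0 < l α, α

/-- The face of the translated zonotope `t +ᵥ zonotope A` on which `l` is maximal: a translate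
of the zonotope of the generators in the kernel of `l`. -/
noncomputable def maxFace (t : E) (A : Finset E) (l : StrongDual ℝ E) : Set E :=
  apex t A l +ᵥ zonotope {α ∈ A | l α = 0}

theorem mem_vadd_zonotope {t x : E} {A : Finset E} :
    x ∈ t +ᵥ zonotope A ↔
      ∃ c : E → ℝ, (∀ α ∈ A, 0 ≤ c α ∧ c α ≤ 1) ∧ x = t + ∑ α ∈ A, c α • α := by
  constructor
  · rintro ⟨_, ⟨c, hc, rfl⟩, rfl⟩
    exact ⟨c, hc, rfl⟩
  · rintro ⟨c, hc, rfl⟩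
    exact ⟨_, ⟨c, hc, rfl⟩, rfl⟩

theorem mem_maxFace {t x : E} {A : Finset E} {l : StrongDual ℝ E} :
    x ∈ maxFace t A l ↔ ∃ c : E → ℝ, (∀ α ∈ A, 0 ≤ c α ∧ c α ≤ 1) ∧
      (∀ α ∈ A, 0 < l α → c α = 1) ∧ (∀ α ∈ A, l α < 0 → c α = 0) ∧
      x = t + ∑ α ∈ A, c α • α := by
  rw [maxFace, mem_vadd_zonotope]
  constructor
  · rintro ⟨c, hc, rfl⟩
    refine ⟨fun α => if 0 < l α then 1 else if l α = 0 then c α else 0, fun α hα => ?_,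
      fun α _ h => if_pos h, fun α _ h => ?_, ?_⟩
    · dsimp only
      split_ifs with h1 h2
      · simp
      · exact hc α (Finset.mem_filter.2 ⟨hα, h2⟩)
      · simp
    · dsimp only
      rw [if_neg h.not_gt, if_neg h.ne]
    · rw [apex, add_assoc, add_right_inj, Finset.sum_filter, Finset.sum_filter,
        ← Finset.sum_add_distrib]
      refine Finset.sum_congr rfl fun α _ => ?_
      by_cases h1 : 0 < l α
      · simp [h1, h1.ne']
      · by_cases h2 : l α = 0 <;> simp [h1, h2]
  · rintro ⟨c, hc, h1, h2, rfl⟩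
    refine ⟨c, fun α hα => hc α (Finset.mem_filter.1 hα).1, ?_⟩
    rw [apex, add_assoc, add_right_inj, Finset.sum_filter, Finset.sum_filter,
      ← Finset.sum_add_distrib]
    refine Finset.sum_congr rfl fun α hα => ?_
    rcases lt_trichotomy (l α) 0 with h | h | h
    · simp [h2 α hα h, h.ne, h.not_gt]
    · simp [h]
    · simp [h1 α hα h, h, h.ne']

theorem setOf_isMax_eq_maxFace (t : E) (A : Finset E) (l : StrongDual ℝ E) :
    {x ∈ t +ᵥ zonotope A | ∀ y ∈ t +ᵥ zonotope A, l y ≤ l x} = maxFace t A l := by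
  ext x
  rw [mem_maxFace, Set.mem_ofPred_eq, mem_vadd_zonotope]
  constructor
  · rintro ⟨⟨c, hc, rfl⟩, hmax⟩
    have key := hmax (t + ∑ α ∈ A with 0 < l α, α)
      (Set.vadd_mem_vadd_set (sum_mem_zonotope (Finset.filter_subset _ _)))
    have hle : ∀ α ∈ A, c α * l α ≤ if 0 < l α then l α else 0 := fun α hα => by
      split_ifs with h
      · nlinarith [hc α hα]
      · nlinarith [hc α hα]
    have heq : ∀ α ∈ A, c α * l α = if 0 < l α then l α else 0 := by
      refine (Finset.sum_eq_sum_iff_of_le hle).1 (le_antisymm (Finset.sum_le_sum hle) ?_)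
      simpa [map_sum, Finset.sum_filter, apply_ite l] using key
    refine ⟨c, hc, fun α hα h => ?_, fun α hα h => ?_, rfl⟩
    · have := heq α hα
      rw [if_pos h] at this
      exact mul_right_cancel₀ h.ne' (this.trans (one_mul _).symm)
    · have := heq α hα
      rw [if_neg h.not_gt] at this
      exact (mul_eq_zero.1 this).resolve_right h.ne
  · rintro ⟨c, hc, h1, h2, rfl⟩
    refine ⟨⟨c, hc, rfl⟩, fun y hy => ?_⟩
    obtain ⟨d, hd, rfl⟩ := mem_vadd_zonotope.1 hy
    simp only [map_add, map_sum, map_smul, smul_eq_mul, add_le_add_iff_left]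
    refine Finset.sum_le_sum fun α hα => ?_
    rcases lt_trichotomy (l α) 0 with h | h | h
    · rw [h2 α hα h]
      nlinarith [hd α hα]
    · simp [h]
    · rw [h1 α hα h]
      nlinarith [hd α hα]

theorem isFace_vadd_zonotope_iff {t : E} {A : Finset E} {F : Set E} :
    IsFace (t +ᵥ zonotope A) F ↔ ∃ l : StrongDual ℝ E, F = maxFace t A l := by
  constructor
  · rintro ⟨hne, hF⟩
    obtain ⟨l, rfl⟩ := hF hne
    exact ⟨l, setOf_isMax_eq_maxFace t A l⟩
  · rintro ⟨l, rfl⟩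
    exact ⟨⟨_, Set.vadd_mem_vadd_set (zero_mem_zonotope _)⟩,
      fun _ => ⟨l, (setOf_isMax_eq_maxFace t A l).symm⟩⟩

theorem vectorSpan_maxFace (t : E) (A : Finset E) (l : StrongDual ℝ E) :
    vectorSpan ℝ (maxFace t A l) = Submodule.span ℝ (({α ∈ A | l α = 0} : Finset E) : Set E) :=
  vectorSpan_vadd_zonotope _ _

/-- The vertex of a generic functional `g` lies on the face of `l` if the signs of `l` on the
generators weakly agree with those of `g`. -/
theorem apex_mem_maxFace {t : E} {A : Finset E} {g l : StrongDual ℝ E} (hg : ∀ α ∈ A, g α ≠ 0)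
    (hpos : ∀ α ∈ A, 0 < g α → 0 ≤ l α) (hneg : ∀ α ∈ A, g α < 0 → l α ≤ 0) :
    apex t A g ∈ maxFace t A l := by
  refine mem_maxFace.2 ⟨fun α => if 0 < g α then 1 else 0, fun α _ => ?_, fun α hα h => ?_,
    fun α hα h => ?_, ?_⟩
  · dsimp only
    split_ifs <;> simp
  · exact if_pos ((hg α hα).lt_or_gt.resolve_left fun h' => h.not_ge (hneg α hα h'))
  · exact if_neg fun h' => h.not_ge (hpos α hα h')
  · simp [apex, Finset.sum_filter]

theorem nonneg_of_apex_mem_maxFace {t : E} {A : Finset E} {g l : StrongDual ℝ E}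
    (h : apex t A g ∈ maxFace t A l) {α : E} (hα : α ∈ A) (hpos : 0 < g α) : 0 ≤ l α := by
  classical
  rw [← setOf_isMax_eq_maxFace] at h
  have hmem : α ∈ ({β ∈ A | 0 < g β} : Finset E) := Finset.mem_filter.2 ⟨hα, hpos⟩
  -- Dropping `α` from the sum defining the vertex gives another point of the zonotope.
  have := h.2 (t + ∑ β ∈ ({β ∈ A | 0 < g β} : Finset E).erase α, β)
    (Set.vadd_mem_vadd_set
      (sum_mem_zonotope ((Finset.erase_subset _ _).trans (Finset.filter_subset _ _))))
  rw [apex, ← Finset.add_sum_erase _ _ hmem] at this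
  simp only [map_add] at this
  linarith

/-- Every face contains a vertex: a small generic perturbation of `l` does not vanish on the
generators and its vertex lies on the face of `l`. -/
theorem exists_apex_mem_maxFace [FiniteDimensional ℝ E] {A : Finset E} (hA : ∀ α ∈ A, α ≠ 0)
    (t : E) (l : StrongDual ℝ E) :
    ∃ g : StrongDual ℝ E, (∀ α ∈ A, g α ≠ 0) ∧ apex t A g ∈ maxFace t A l := by
  obtain ⟨f, hf⟩ := Module.exists_dual_forall_apply_ne_zero (K := ℝ)
    (fun α : A => (α : E)) (fun α => hA α α.2)
  have key : ∀ α ∈ A, ∀ᶠ ε : ℝ in nhdsWithin 0 (Set.Ioi 0),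
      l α + ε * f α ≠ 0 ∧ (0 < l α + ε * f α → 0 ≤ l α) ∧ (l α + ε * f α < 0 → l α ≤ 0) := by
    intro α hα
    have hlim : Filter.Tendsto (fun ε : ℝ => l α + ε * f α) (nhdsWithin 0 (Set.Ioi 0))
        (nhds (l α)) := by
      have : Continuous fun ε : ℝ => l α + ε * f α := by fun_prop
      simpa using (this.tendsto 0).mono_left nhdsWithin_le_nhds
    rcases lt_trichotomy (l α) 0 with h | h | h
    · filter_upwards [hlim.eventually_lt_const h] with ε hε
      exact ⟨hε.ne, fun h' => absurd h' hε.not_gt, fun _ => h.le⟩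
    · filter_upwards [self_mem_nhdsWithin] with ε hε
      rw [h]
      exact ⟨by simpa using ⟨ne_of_gt hε, hf ⟨α, hα⟩⟩, fun _ => le_rfl, fun _ => le_rfl⟩
    · filter_upwards [hlim.eventually_const_lt h] with ε hε
      exact ⟨hε.ne', fun _ => h.le, fun h' => absurd h' hε.not_gt⟩
  obtain ⟨ε, hε⟩ := ((Filter.eventually_all_finset A).2 key).exists
  refine ⟨l + ε • LinearMap.toContinuousLinearMap f, fun α hα => (hε α hα).1,
    apex_mem_maxFace (fun α hα => (hε α hα).1) (fun α hα => (hε α hα).2.1)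
      fun α hα => (hε α hα).2.2⟩

end Zonotopes

/-! ### Simple systems -/

section SimpleSystems

open scoped NNReal

variable {E : Type*} [NormedAddCommGroup E] [InnerProductSpace ℝ E]

/-- A finite set of unit vectors stable under the reflections in its members. -/
structure IsUnitRootSystem (A : Finset E) : Prop where
  norm_eq_one : ∀ α ∈ A, ‖α‖ = 1
  reflection_mem : ∀ α ∈ A, ∀ β ∈ A, β - (2 * inner ℝ α β) • α ∈ A

theorem IsUnitRootSystem.inner_self {A : Finset E} (hA : IsUnitRootSystem A) {α : E}
    (hα : α ∈ A) : inner ℝ α α = (1 : ℝ) := by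
  rw [real_inner_self_eq_norm_sq, hA.norm_eq_one α hα, one_pow]

theorem IsUnitRootSystem.ne_zero {A : Finset E} (hA : IsUnitRootSystem A) :
    ∀ α ∈ A, α ≠ 0 := fun α hα h => by
  simpa [h] using hA.norm_eq_one α hα

theorem IsUnitRootSystem.neg_mem {A : Finset E} (hA : IsUnitRootSystem A) {α : E}
    (hα : α ∈ A) : -α ∈ A := by
  have := hA.reflection_mem α hα α hα
  rwa [hA.inner_self hα, mul_one, two_smul, sub_add_cancel_left] at this

/-- The roots orthogonal to a vector, here given as the kernel of a functional, form a root
system. -/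
theorem IsUnitRootSystem.filter {A : Finset E} (hA : IsUnitRootSystem A)
    (l : StrongDual ℝ E) : IsUnitRootSystem {α ∈ A | l α = 0} := by
  refine ⟨fun α hα => hA.norm_eq_one α (Finset.mem_filter.1 hα).1, fun α hα β hβ => ?_⟩
  rw [Finset.mem_filter] at *
  exact ⟨hA.reflection_mem α hα.1 β hβ.1, by simp [hα.2, hβ.2]⟩

/-- `Δ` is a simple system for the positive roots `{α ∈ A | 0 < g α}`. -/
structure IsSimpleSystem (A : Finset E) (g : StrongDual ℝ E) (Δ : Finset E) : Prop where
  subset : Δ ⊆ A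
  pos : ∀ γ ∈ Δ, 0 < g γ
  exists_eq_sum : ∀ α ∈ A, 0 < g α → ∃ c : E → ℝ, (∀ γ ∈ Δ, 0 ≤ c γ) ∧ α = ∑ γ ∈ Δ, c γ • γ
  inner_nonpos : ∀ γ ∈ Δ, ∀ δ ∈ Δ, γ ≠ δ → inner ℝ γ δ ≤ (0 : ℝ)

theorem mem_span_nnreal_finset {B : Finset E} {x : E} :
    x ∈ Submodule.span ℝ≥0 (B : Set E) ↔
      ∃ c : E → ℝ, (∀ γ ∈ B, 0 ≤ c γ) ∧ x = ∑ γ ∈ B, c γ • γ := by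
  constructor
  · intro hx
    obtain ⟨f, -, rfl⟩ := Submodule.mem_span_finset.1 hx
    exact ⟨fun γ => f γ, fun γ _ => (f γ).2, rfl⟩
  · rintro ⟨c, hc, rfl⟩
    refine Submodule.sum_mem _ fun γ hγ => ?_
    exact Submodule.smul_mem _ (⟨c γ, hc γ hγ⟩ : ℝ≥0) (Submodule.subset_span hγ)

/-- In an open half-space, a vector that is a nonnegative combination involving some other
generator is redundant. -/
theorem mem_span_nnreal_erase [DecidableEq E] {Δ : Finset E} {g : StrongDual ℝ E}
    (hpos : ∀ γ ∈ Δ, 0 < g γ) {δ ε : E} (hδ : δ ∈ Δ) (hε : ε ∈ Δ) (hne : ε ≠ δ) {b : E → ℝ}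
    (hb : ∀ γ ∈ Δ, 0 ≤ b γ) (hbε : 0 < b ε) (h : δ = ∑ γ ∈ Δ, b γ • γ) :
    δ ∈ Submodule.span ℝ≥0 (Δ.erase δ : Set E) := by
  have h1 : (1 - b δ) • δ = ∑ γ ∈ Δ.erase δ, b γ • γ := by
    rw [← Finset.add_sum_erase _ _ hδ] at h
    rw [sub_smul, one_smul, sub_eq_iff_eq_add']
    exact h
  have h2 : 0 < g (∑ γ ∈ Δ.erase δ, b γ • γ) := by
    simp only [map_sum, map_smul, smul_eq_mul]
    refine Finset.sum_pos' (fun γ hγ => ?_) ⟨ε, Finset.mem_erase.2 ⟨hne, hε⟩, ?_⟩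
    · exact mul_nonneg (hb γ (Finset.mem_of_mem_erase hγ))
        (hpos γ (Finset.mem_of_mem_erase hγ)).le
    · exact mul_pos hbε (hpos ε hε)
  have h3 : 0 < 1 - b δ := by
    rw [← h1, map_smul, smul_eq_mul] at h2
    exact pos_of_mul_pos_left h2 (hpos δ hδ).le
  rw [mem_span_nnreal_finset]
  refine ⟨fun γ => (1 - b δ)⁻¹ * b γ, fun γ hγ =>
    mul_nonneg (inv_nonneg.2 h3.le) (hb γ (Finset.mem_of_mem_erase hγ)), ?_⟩
  simp only [mul_smul]
  rw [← Finset.smul_sum, ← h1, smul_smul, inv_mul_cancel₀ h3.ne', one_smul]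

/-- A set of positive roots that generates all positive roots and has minimal cardinality is a
simple system. If two of its members `γ ≠ δ` had a positive inner product, then the reflection of
`δ` in `γ` or its negative would be positive, and expanding it would make `δ` or `γ`
redundant. -/
theorem exists_isSimpleSystem {A : Finset E} (hA : IsUnitRootSystem A) {g : StrongDual ℝ E}
    (hg : ∀ α ∈ A, g α ≠ 0) : ∃ Δ, IsSimpleSystem A g Δ := by
  classical
  set P : Finset E := {α ∈ A | 0 < g α} with hP
  obtain ⟨Δ, hΔ, hmin⟩ := Finset.exists_min_image
    (P.powerset.filter fun B : Finset E => (P : Set E) ⊆ Submodule.span ℝ≥0 (B : Set E)) Finset.card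
    ⟨P, by simp [Submodule.subset_span]⟩
  rw [Finset.mem_filter, Finset.mem_powerset] at hΔ
  obtain ⟨hΔP, hspan⟩ := hΔ
  have hpos : ∀ γ ∈ Δ, 0 < g γ := fun γ hγ => (Finset.mem_filter.1 (hΔP hγ)).2
  have hΔA : Δ ⊆ A := hΔP.trans (Finset.filter_subset _ _)
  have hirr : ∀ δ ∈ Δ, δ ∉ Submodule.span ℝ≥0 (Δ.erase δ : Set E) := by
    intro δ hδ hmem
    refine (Finset.card_erase_lt_of_mem hδ).not_ge (hmin _ ?_)
    rw [Finset.mem_filter, Finset.mem_powerset]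
    refine ⟨(Finset.erase_subset _ _).trans hΔP, hspan.trans ?_⟩
    refine SetLike.coe_subset_coe.2 (Submodule.span_le.2 fun γ hγ => ?_)
    by_cases h : γ = δ
    · rwa [h]
    · exact Submodule.subset_span (Finset.mem_erase.2 ⟨h, hγ⟩)
  have hsum : ∀ α ∈ A, 0 < g α →
      ∃ c : E → ℝ, (∀ γ ∈ Δ, 0 ≤ c γ) ∧ α = ∑ γ ∈ Δ, c γ • γ := fun α hα h =>
    mem_span_nnreal_finset.1 (hspan (Finset.mem_filter.2 ⟨hα, h⟩))
  refine ⟨Δ, hΔA, hpos, hsum, fun γ hγ δ hδ hne => ?_⟩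
  by_contra! hlt
  set c : ℝ := 2 * inner ℝ γ δ with hc
  have hc0 : 0 < c := by positivity
  have hρ := hA.reflection_mem γ (hΔA hγ) δ (hΔA hδ)
  rw [← hc] at hρ
  rcases (hg _ hρ).lt_or_gt with h | h
  · obtain ⟨b, hb, hb'⟩ := hsum _ (hA.neg_mem hρ) (by rw [map_neg]; linarith)
    refine hirr γ hγ (mem_span_nnreal_erase hpos hγ hδ hne.symm
      (b := fun ε => c⁻¹ * (b ε + if ε = δ then 1 else 0)) (fun ε hε => ?_) ?_ ?_)
    · have := hb ε hε
      split_ifs <;> positivity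
    · have := hb δ hδ
      simp only [if_true]
      positivity
    · simp only [mul_smul, add_smul, ite_smul, one_smul, zero_smul]
      rw [← Finset.smul_sum, Finset.sum_add_distrib, ← hb', Finset.sum_ite_eq', if_pos hδ,
        neg_sub, sub_add_cancel, smul_smul, inv_mul_cancel₀ hc0.ne', one_smul]
  · obtain ⟨b, hb, hb'⟩ := hsum _ hρ h
    refine hirr δ hδ (mem_span_nnreal_erase hpos hδ hγ hne
      (b := fun ε => b ε + if ε = γ then c else 0) (fun ε hε => ?_) ?_ ?_)
    · have := hb ε hε
      split_ifs <;> positivity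
    · have := hb γ hγ
      simp only [if_true]
      positivity
    · simp only [add_smul, ite_smul, zero_smul]
      rw [Finset.sum_add_distrib, ← hb', Finset.sum_ite_eq', if_pos hγ, sub_add_cancel]

/-- The basic property of vectors in an open half-space at pairwise non-acute angles: the inverse
of their Gram matrix has nonnegative entries. The positive part `p` of the combination satisfies
`⟪p, p⟫ ≤ 0`, so it vanishes, and the half-space condition kills its coefficients. -/
theorem coeff_nonpos {Δ : Finset E} {g : StrongDual ℝ E} (hpos : ∀ γ ∈ Δ, 0 < g γ)
    (hobt : ∀ γ ∈ Δ, ∀ δ ∈ Δ, γ ≠ δ → inner ℝ γ δ ≤ (0 : ℝ)) {d : E → ℝ}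
    (h : ∀ γ ∈ Δ, inner ℝ (∑ δ ∈ Δ, d δ • δ) γ ≤ (0 : ℝ)) : ∀ γ ∈ Δ, d γ ≤ 0 := by
  set q : E := ∑ δ ∈ Δ, d δ • δ with hq
  set p : E := ∑ δ ∈ Δ, max (d δ) 0 • δ with hp
  have h1 : inner ℝ q p ≤ (0 : ℝ) := by
    rw [hp, inner_sum]
    refine Finset.sum_nonpos fun γ hγ => ?_
    rw [inner_smul_right]
    exact mul_nonpos_of_nonneg_of_nonpos (le_max_right _ _) (h γ hγ)
  have h2 : inner ℝ (p - q) p ≤ (0 : ℝ) := by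
    rw [show p - q = ∑ δ ∈ Δ, (max (d δ) 0 - d δ) • δ by
      rw [hp, hq, ← Finset.sum_sub_distrib]; simp only [sub_smul], sum_inner]
    refine Finset.sum_nonpos fun γ hγ => ?_
    rw [hp, inner_sum]
    refine Finset.sum_nonpos fun δ hδ => ?_
    rw [inner_smul_left, inner_smul_right]
    have hγ' : 0 ≤ max (d γ) 0 - d γ := sub_nonneg.2 (le_max_left _ _)
    by_cases hne : γ = δ
    · subst hne
      rcases le_total (d γ) 0 with h | h <;> simp [h]
    · exact mul_nonpos_of_nonneg_of_nonpos hγ'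
        (mul_nonpos_of_nonneg_of_nonpos (le_max_right _ _) (hobt γ hγ δ hδ hne))
  have h3 : p = 0 := by
    rw [inner_sub_left] at h2
    exact (re_inner_self_nonpos (𝕜 := ℝ)).1 (by rw [RCLike.re_to_real]; linarith)
  have h4 : ∑ δ ∈ Δ, max (d δ) 0 * g δ = 0 := by
    simpa [hp] using congrArg g h3
  intro γ hγ
  have h5 := (Finset.sum_eq_zero_iff_of_nonneg fun δ hδ =>
    mul_nonneg (le_max_right (d δ) 0) (hpos δ hδ).le).1 h4 γ hγ
  exact max_eq_right_iff.1 ((mul_eq_zero.1 h5).resolve_right (hpos γ hγ).ne')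

theorem linearIndepOn_of_inner_nonpos {Δ : Finset E} {g : StrongDual ℝ E}
    (hpos : ∀ γ ∈ Δ, 0 < g γ)
    (hobt : ∀ γ ∈ Δ, ∀ δ ∈ Δ, γ ≠ δ → inner ℝ γ δ ≤ (0 : ℝ)) :
    LinearIndepOn ℝ id (Δ : Set E) := by
  rw [linearIndepOn_finset_iff]
  intro f hf γ hγ
  simp only [id] at hf
  refine le_antisymm (coeff_nonpos hpos hobt (fun δ _ => by rw [hf, inner_zero_left]) γ hγ) ?_
  have hf' : ∑ δ ∈ Δ, (-f δ) • δ = 0 := by simp [hf]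
  exact neg_nonpos.1 (coeff_nonpos (d := fun δ => -f δ) hpos hobt
    (fun δ _ => by rw [hf', inner_zero_left]) γ hγ)

namespace IsSimpleSystem

variable {A Δ : Finset E} {g : StrongDual ℝ E}

theorem linearIndepOn (hΔ : IsSimpleSystem A g Δ) : LinearIndepOn ℝ id (Δ : Set E) :=
  linearIndepOn_of_inner_nonpos hΔ.pos hΔ.inner_nonpos

theorem notMem_span (hΔ : IsSimpleSystem A g Δ) {γ : E} {S : Finset E} (hγ : γ ∈ Δ)
    (hS : S ⊆ Δ) (h : γ ∉ S) : γ ∉ Submodule.span ℝ (S : Set E) := fun hmem => by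
  refine hΔ.linearIndepOn.notMem_span hγ (Submodule.span_mono ?_ hmem)
  rw [Set.image_id]
  exact fun x hx => ⟨hS hx, fun hxγ => h (hxγ ▸ hx)⟩

theorem finrank_span (hΔ : IsSimpleSystem A g Δ) {S : Finset E} (hS : S ⊆ Δ) :
    Module.finrank ℝ (Submodule.span ℝ (S : Set E)) = S.card :=
  finrank_span_finset_eq_card (hΔ.linearIndepOn.mono (Finset.coe_subset.2 hS))

end IsSimpleSystem

end SimpleSystems

/-! ### Orthogonal parts of simple roots -/

section PerpPart

variable {E : Type*} [NormedAddCommGroup E] [InnerProductSpace ℝ E]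

/-- The component of `x` orthogonal to the span of `S`. -/
noncomputable def perpPart (S : Finset E) (x : E) : E :=
  x - (Submodule.span ℝ (S : Set E)).starProjection x

theorem perpPart_mem_orthogonal (S : Finset E) (x : E) :
    perpPart S x ∈ (Submodule.span ℝ (S : Set E))ᗮ :=
  Submodule.sub_starProjection_mem_orthogonal x

theorem inner_perpPart_eq_zero {S : Finset E} {x y : E}
    (hy : y ∈ Submodule.span ℝ (S : Set E)) : inner ℝ (perpPart S x) y = (0 : ℝ) :=
  Submodule.inner_left_of_mem_orthogonal hy (perpPart_mem_orthogonal S x)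

theorem inner_perpPart_perpPart (S : Finset E) (x y : E) :
    inner ℝ (perpPart S x) (perpPart S y) = (inner ℝ x (perpPart S y) : ℝ) := by
  conv_lhs => rw [perpPart, inner_sub_left]
  rw [real_inner_comm (perpPart S y) (Submodule.starProjection _ x),
    inner_perpPart_eq_zero (Submodule.starProjection_apply_mem _ x), sub_zero]

theorem perpPart_ne_zero {S : Finset E} {x : E}
    (hx : x ∉ Submodule.span ℝ (S : Set E)) : perpPart S x ≠ 0 := fun h => by
  rw [perpPart, sub_eq_zero] at h
  exact hx (h ▸ Submodule.starProjection_apply_mem _ x)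

namespace IsSimpleSystem

variable {A Δ : Finset E} {g : StrongDual ℝ E}

theorem perpPart_eq_add_sum (hΔ : IsSimpleSystem A g Δ) {S : Finset E} (hS : S ⊆ Δ) {j : E}
    (hj : j ∈ Δ) (hjS : j ∉ S) :
    ∃ e : E → ℝ, (∀ γ ∈ S, 0 ≤ e γ) ∧ perpPart S j = j + ∑ γ ∈ S, e γ • γ := by
  obtain ⟨d, -, hd⟩ := Submodule.mem_span_finset.1
    (Submodule.starProjection_apply_mem (Submodule.span ℝ (S : Set E)) j)
  refine ⟨fun γ => -d γ, fun γ hγ => neg_nonneg.2 ?_, ?_⟩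
  · refine coeff_nonpos (fun δ hδ => hΔ.pos δ (hS hδ))
      (fun δ hδ ε hε => hΔ.inner_nonpos δ (hS hδ) ε (hS hε)) (fun δ hδ => ?_) γ hγ
    have h := inner_perpPart_eq_zero (x := j) (Submodule.subset_span (R := ℝ) hδ)
    rw [perpPart, inner_sub_left, sub_eq_zero] at h
    rw [hd, ← h]
    exact hΔ.inner_nonpos j hj δ (hS hδ) fun h' => hjS (h' ▸ hδ)
  · simp only [neg_smul, Finset.sum_neg_distrib]
    rw [hd, perpPart, sub_eq_add_neg]

/-- The orthogonal parts of two simple roots with respect to other simple roots form a non-acute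
angle, because the orthogonal part of `j` is `j` plus a nonnegative combination of `S`. -/
theorem inner_perpPart_nonpos (hΔ : IsSimpleSystem A g Δ) {S : Finset E} (hS : S ⊆ Δ) {i j : E}
    (hi : i ∈ Δ) (hj : j ∈ Δ) (hij : i ≠ j) (hiS : i ∉ S) (hjS : j ∉ S) :
    inner ℝ (perpPart S i) (perpPart S j) ≤ (0 : ℝ) := by
  obtain ⟨e, he, hj'⟩ := hΔ.perpPart_eq_add_sum hS hj hjS
  rw [inner_perpPart_perpPart, hj', inner_add_right, inner_sum]
  refine add_nonpos (hΔ.inner_nonpos i hi j hj hij) (Finset.sum_nonpos fun γ hγ => ?_)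
  rw [inner_smul_right]
  exact mul_nonpos_of_nonneg_of_nonpos (he γ hγ)
    (hΔ.inner_nonpos i hi γ (hS hγ) fun h => hiS (h ▸ hγ))

/-- If the orthogonal parts of the two simple roots outside `S` are orthogonal to each other, then
the simple system splits. The part containing `j` is the support of `perpPart S j`, the
connected component of `j` in the Coxeter graph with `i` removed. -/
theorem exists_split_of_inner_perpPart_eq_zero [DecidableEq E] (hΔ : IsSimpleSystem A g Δ)
    {S : Finset E} {i j : E} (hΔS : insert i (insert j S) = Δ) (hij : i ≠ j) (hiS : i ∉ S)
    (hjS : j ∉ S) (h0 : inner ℝ (perpPart S i) (perpPart S j) = (0 : ℝ)) :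
    ∃ D ⊆ Δ, j ∈ D ∧ i ∉ D ∧ ∀ γ ∈ D, ∀ δ ∈ Δ \ D, inner ℝ γ δ = (0 : ℝ) := by
  have hi : i ∈ Δ := by simp [← hΔS]
  have hj : j ∈ Δ := by simp [← hΔS]
  have hS : S ⊆ Δ := fun x hx => by simp [← hΔS, hx]
  obtain ⟨e, he, hj'⟩ := hΔ.perpPart_eq_add_sum hS hj hjS
  set D : Finset E := insert j {γ ∈ S | e γ ≠ 0} with hD
  have hDΔ : D ⊆ Δ := Finset.insert_subset hj ((Finset.filter_subset _ _).trans hS)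
  have hiD : i ∉ D := by simp [hD, hij, hiS]
  refine ⟨D, hDΔ, Finset.mem_insert_self _ _, hiD, fun γ hγ δ hδ => ?_⟩
  obtain ⟨hδΔ, hδD⟩ := Finset.mem_sdiff.1 hδ
  -- Every simple root outside `D` is orthogonal to `perpPart S j`, a combination of `D` with
  -- positive coefficients, and makes no acute angle with the members of `D`.
  have hδ0 : inner ℝ δ (perpPart S j) = (0 : ℝ) := by
    rw [← hΔS, Finset.mem_insert, Finset.mem_insert] at hδΔ
    rcases hδΔ with rfl | rfl | h
    · rwa [← inner_perpPart_perpPart]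
    · exact absurd (Finset.mem_insert_self _ _) hδD
    · rw [real_inner_comm]
      exact inner_perpPart_eq_zero (Submodule.subset_span h)
  have hδj : inner ℝ δ j ≤ (0 : ℝ) :=
    hΔ.inner_nonpos δ hδΔ j hj fun h => hδD (h ▸ Finset.mem_insert_self _ _)
  have hδS : ∀ ε ∈ S, e ε * inner ℝ δ ε ≤ (0 : ℝ) := fun ε hε => by
    by_cases h : e ε = 0
    · simp [h]
    · refine mul_nonpos_of_nonneg_of_nonpos (he ε hε) (hΔ.inner_nonpos δ hδΔ ε (hS hε) ?_)
      rintro rfl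
      exact hδD (by simp [hD, hε, h])
  rw [hj', inner_add_right, inner_sum] at hδ0
  simp only [inner_smul_right] at hδ0
  have hsum := Finset.sum_nonpos hδS
  rw [real_inner_comm]
  rw [hD, Finset.mem_insert, Finset.mem_filter] at hγ
  rcases hγ with rfl | ⟨hγS, hγe⟩
  · linarith
  · have := (Finset.sum_eq_zero_iff_of_nonpos hδS).1 (by linarith) γ hγS
    exact (mul_eq_zero.1 this).resolve_left hγe

/-- If the simple system splits into orthogonal parts, so does the root system. Some simple
reflection `s_γ` lowers the value of `g` at a positive root in neither span. If `g` is minimal at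
that root, then either its image lies in one of the spans or its image is negative; both force the
root itself into one of the spans. -/
theorem mem_span_or_mem_span [DecidableEq E] (hA : IsUnitRootSystem A)
    (hg : ∀ α ∈ A, g α ≠ 0) (hΔ : IsSimpleSystem A g Δ) {D : Finset E}
    (hD : ∀ γ ∈ D, ∀ δ ∈ Δ \ D, inner ℝ γ δ = (0 : ℝ)) {α : E} (hα : α ∈ A) :
    α ∈ Submodule.span ℝ (D : Set E) ∨ α ∈ Submodule.span ℝ ((Δ \ D : Finset E) : Set E) := by
  set U := Submodule.span ℝ (D : Set E)
  set V := Submodule.span ℝ ((Δ \ D : Finset E) : Set E)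
  have hUV : ∀ x ∈ U, ∀ y ∈ V, inner ℝ x y = (0 : ℝ) := by
    have h : U ⟂ V := Submodule.isOrtho_span.2 fun x hx y hy => hD x hx y hy
    exact fun x hx y hy => Submodule.isOrtho_iff_inner_eq.1 h x hx y hy
  suffices hpos : ∀ α ∈ A, 0 < g α → α ∈ U ∨ α ∈ V by
    rcases (hg α hα).lt_or_gt with h | h
    · rw [← U.neg_mem_iff, ← V.neg_mem_iff]
      exact hpos _ (hA.neg_mem hα) (by rw [map_neg]; linarith)
    · exact hpos α hα h
  classical
  by_contra! hbad
  obtain ⟨α₀, hα₀, hα₀g, hα₀U, hα₀V⟩ := hbad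
  obtain ⟨β, hβ, hmin⟩ := Finset.exists_min_image {β ∈ A | 0 < g β ∧ β ∉ U ∧ β ∉ V} g
    ⟨α₀, Finset.mem_filter.2 ⟨hα₀, hα₀g, hα₀U, hα₀V⟩⟩
  simp only [Finset.mem_filter] at hβ hmin
  obtain ⟨hβA, hβg, hβU, hβV⟩ := hβ
  obtain ⟨b, hb, hβb⟩ := hΔ.exists_eq_sum β hβA hβg
  obtain ⟨γ, hγ, hγpos⟩ : ∃ γ ∈ Δ, 0 < inner ℝ γ β := by
    by_contra! h
    have h1 : inner ℝ β β ≤ (0 : ℝ) := by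
      conv_lhs => rw [hβb]
      rw [sum_inner, ← hβb]
      refine Finset.sum_nonpos fun γ hγ => ?_
      rw [inner_smul_left]
      exact mul_nonpos_of_nonneg_of_nonpos (hb γ hγ) (h γ hγ)
    rw [hA.inner_self hβA] at h1
    exact absurd h1 (by norm_num)
  have hγUV : γ ∈ U ∨ γ ∈ V := by
    by_cases h : γ ∈ D
    · exact Or.inl (Submodule.subset_span h)
    · exact Or.inr (Submodule.subset_span (Finset.mem_coe.2 (Finset.mem_sdiff.2 ⟨hγ, h⟩)))
  set c : ℝ := 2 * inner ℝ γ β with hc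
  have hc0 : 0 < c := by positivity
  have hρ := hA.reflection_mem γ (hΔ.subset hγ) β hβA
  rw [← hc] at hρ
  have hγγ : inner ℝ γ γ = (1 : ℝ) := hA.inner_self (hΔ.subset hγ)
  have hρneg : inner ℝ γ (β - c • γ) < (0 : ℝ) := by
    rw [inner_sub_right, inner_smul_right, hγγ]
    linarith
  rcases (hg _ hρ).lt_or_gt with h | h
  · -- The reflected root is negative, so `β` is proportional to `γ`.
    obtain ⟨a, ha, hab⟩ := hΔ.exists_eq_sum _ (hA.neg_mem hρ) (by rw [map_neg]; linarith)
    have h1 : ∑ δ ∈ Δ, (b δ + a δ - if δ = γ then c else 0) • δ = 0 := by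
      simp only [sub_smul, add_smul, ite_smul, zero_smul]
      rw [Finset.sum_sub_distrib, Finset.sum_add_distrib, ← hβb, ← hab, Finset.sum_ite_eq',
        if_pos hγ]
      abel
    have h2 := linearIndepOn_finset_iff.1 hΔ.linearIndepOn _ h1
    have h3 : β = b γ • γ := by
      rw [hβb]
      refine Finset.sum_eq_single_of_mem γ hγ fun δ hδ hne => ?_
      have := h2 δ hδ
      rw [if_neg hne] at this
      rw [show b δ = 0 by linarith [hb δ hδ, ha δ hδ], zero_smul]
    rcases hγUV with h | h
    · exact hβU (h3 ▸ U.smul_mem _ h)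
    · exact hβV (h3 ▸ V.smul_mem _ h)
  · have hlt : g (β - c • γ) < g β := by
      rw [map_sub, map_smul, smul_eq_mul]
      linarith [mul_pos hc0 (hΔ.pos γ hγ)]
    have hρUV : β - c • γ ∈ U ∨ β - c • γ ∈ V := by
      by_contra! h'
      exact hlt.not_ge (hmin _ ⟨hρ, h, h'⟩)
    have hβ' : β = (β - c • γ) + c • γ := (sub_add_cancel _ _).symm
    rcases hγUV with h1 | h1 <;> rcases hρUV with h2 | h2
    · exact hβU (hβ' ▸ U.add_mem h2 (U.smul_mem _ h1))
    · exact hρneg.ne (hUV _ h1 _ h2)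
    · exact hρneg.ne (by rw [real_inner_comm]; exact hUV _ h2 _ h1)
    · exact hβV (hβ' ▸ V.add_mem h2 (V.smul_mem _ h1))

end IsSimpleSystem

end PerpPart

/-! ### The faces of a root zonotope at a vertex -/

section Faces

open Pointwise

variable {E : Type*} [NormedAddCommGroup E] [InnerProductSpace ℝ E]
  {A Δ : Finset E} {g l : StrongDual ℝ E} {t : E}

theorem IsUnitRootSystem.apex_mem_maxFace_iff (hA : IsUnitRootSystem A)
    (hg : ∀ α ∈ A, g α ≠ 0) (hΔ : IsSimpleSystem A g Δ) :
    apex t A g ∈ maxFace t A l ↔ ∀ γ ∈ Δ, 0 ≤ l γ := by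
  refine ⟨fun h γ hγ => nonneg_of_apex_mem_maxFace h (hΔ.subset hγ) (hΔ.pos γ hγ), fun h => ?_⟩
  have hpos : ∀ α ∈ A, 0 < g α → 0 ≤ l α := fun α hα hgα => by
    obtain ⟨c, hc, rfl⟩ := hΔ.exists_eq_sum α hα hgα
    simp only [map_sum, map_smul, smul_eq_mul]
    exact Finset.sum_nonneg fun γ hγ => mul_nonneg (hc γ hγ) (h γ hγ)
  refine apex_mem_maxFace hg hpos fun α hα hgα => ?_
  have := hpos (-α) (hA.neg_mem hα) (by rw [map_neg]; linarith)
  rw [map_neg] at this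
  linarith

namespace IsSimpleSystem

theorem exists_eq_sum_filter (hΔ : IsSimpleSystem A g Δ) (hl : ∀ γ ∈ Δ, 0 ≤ l γ) {α : E}
    (hα : α ∈ A) (hgα : 0 < g α) (hlα : l α = 0) :
    ∃ c : E → ℝ, (∀ γ ∈ Δ, 0 ≤ c γ) ∧ α = ∑ γ ∈ Δ with l γ = 0, c γ • γ := by
  obtain ⟨c, hc, hαc⟩ := hΔ.exists_eq_sum α hα hgα
  refine ⟨c, hc, ?_⟩
  have h : ∑ γ ∈ Δ, c γ * l γ = 0 := by
    rw [hαc] at hlα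
    simpa using hlα
  rw [Finset.sum_eq_zero_iff_of_nonneg fun γ hγ => mul_nonneg (hc γ hγ) (hl γ hγ)] at h
  conv_lhs => rw [hαc]
  refine (Finset.sum_filter_of_ne fun γ hγ hne => ?_).symm
  refine (mul_eq_zero.1 (h γ hγ)).resolve_left fun h' => hne ?_
  rw [h', zero_smul]

theorem span_filter (hA : IsUnitRootSystem A) (hg : ∀ α ∈ A, g α ≠ 0)
    (hΔ : IsSimpleSystem A g Δ) (hl : ∀ γ ∈ Δ, 0 ≤ l γ) :
    Submodule.span ℝ (({α ∈ A | l α = 0} : Finset E) : Set E) =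
      Submodule.span ℝ (({γ ∈ Δ | l γ = 0} : Finset E) : Set E) := by
  refine le_antisymm (Submodule.span_le.2 fun α hα => ?_) (Submodule.span_mono ?_)
  · obtain ⟨hαA, hlα⟩ := Finset.mem_filter.1 (Finset.mem_coe.1 hα)
    have key : ∀ β ∈ A, 0 < g β → l β = 0 →
        β ∈ Submodule.span ℝ (({γ ∈ Δ | l γ = 0} : Finset E) : Set E) := by
      intro β hβ hgβ hlβ
      obtain ⟨c, -, hβc⟩ := hΔ.exists_eq_sum_filter hl hβ hgβ hlβ
      rw [hβc]
      exact Submodule.sum_mem _ fun γ hγ => Submodule.smul_mem _ _ (Submodule.subset_span hγ)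
    rcases (hg α hαA).lt_or_gt with h | h
    · rw [SetLike.mem_coe, ← Submodule.neg_mem_iff]
      exact key _ (hA.neg_mem hαA) (by rw [map_neg]; linarith) (by simp [hlα])
    · exact key α hαA h hlα
  · exact Finset.coe_subset.2 (Finset.filter_subset_filter _ hΔ.subset)

theorem dim_maxFace (hA : IsUnitRootSystem A) (hg : ∀ α ∈ A, g α ≠ 0)
    (hΔ : IsSimpleSystem A g Δ) (hl : ∀ γ ∈ Δ, 0 ≤ l γ) :
    dim (maxFace t A l) = Finset.card {γ ∈ Δ | l γ = 0} := by
  rw [dim, vectorSpan_maxFace, span_filter hA hg hΔ hl,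
    hΔ.finrank_span (Finset.filter_subset _ _)]

theorem dim_vadd_zonotope (hA : IsUnitRootSystem A) (hg : ∀ α ∈ A, g α ≠ 0)
    (hΔ : IsSimpleSystem A g Δ) : dim (t +ᵥ zonotope A) = Δ.card := by
  have := dim_maxFace (t := t) (l := 0) hA hg hΔ (by simp)
  simpa [maxFace, apex] using this

/-- A face containing the vertex of `g` is determined by the simple roots parallel to it. -/
theorem maxFace_eq_maxFace (hA : IsUnitRootSystem A) (hg : ∀ α ∈ A, g α ≠ 0)
    (hΔ : IsSimpleSystem A g Δ) {l' : StrongDual ℝ E} (hl : ∀ γ ∈ Δ, 0 ≤ l γ)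
    (hl' : ∀ γ ∈ Δ, 0 ≤ l' γ) (h : ∀ γ ∈ Δ, l γ = 0 ↔ l' γ = 0) :
    maxFace t A l = maxFace t A l' := by
  have hpos : ∀ α ∈ A, 0 < g α → 0 ≤ l α ∧ 0 ≤ l' α ∧ (l α = 0 ↔ l' α = 0) := by
    intro α hα hgα
    obtain ⟨c, hc, rfl⟩ := hΔ.exists_eq_sum α hα hgα
    have h1 : ∀ γ ∈ Δ, 0 ≤ c γ * l γ := fun γ hγ => mul_nonneg (hc γ hγ) (hl γ hγ)
    have h2 : ∀ γ ∈ Δ, 0 ≤ c γ * l' γ := fun γ hγ => mul_nonneg (hc γ hγ) (hl' γ hγ)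
    simp only [map_sum, map_smul, smul_eq_mul]
    refine ⟨Finset.sum_nonneg h1, Finset.sum_nonneg h2, ?_⟩
    rw [Finset.sum_eq_zero_iff_of_nonneg h1, Finset.sum_eq_zero_iff_of_nonneg h2]
    exact forall₂_congr fun γ hγ => by rw [mul_eq_zero, mul_eq_zero, h γ hγ]
  have hall : ∀ α ∈ A, (l α = 0 ↔ l' α = 0) ∧ (0 < l α ↔ 0 < l' α) := by
    intro α hα
    rcases (hg α hα).lt_or_gt with hgα | hgα
    · obtain ⟨h1, h2, h3⟩ := hpos (-α) (hA.neg_mem hα) (by rw [map_neg]; linarith)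
      simp only [map_neg, Left.nonneg_neg_iff, neg_eq_zero] at h1 h2 h3
      exact ⟨h3, iff_of_false h1.not_gt h2.not_gt⟩
    · obtain ⟨h1, h2, h3⟩ := hpos α hα hgα
      exact ⟨h3, by rw [h1.lt_iff_ne', h2.lt_iff_ne', ne_eq, ne_eq, h3]⟩
  rw [maxFace, maxFace, apex, apex, Finset.filter_congr fun α hα => (hall α hα).1,
    Finset.filter_congr fun α hα => (hall α hα).2]

/-- Since the simple roots are linearly independent, any set of them is the set of simple roots
parallel to some face at the vertex. -/
theorem exists_functional [FiniteDimensional ℝ E] (hΔ : IsSimpleSystem A g Δ) (S : Set E) :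
    ∃ l : StrongDual ℝ E, (∀ γ ∈ Δ, 0 ≤ l γ) ∧ ∀ γ ∈ Δ, l γ = 0 ↔ γ ∈ S := by
  classical
  set b := Module.Basis.extend hΔ.linearIndepOn
  set f : E →ₗ[ℝ] ℝ := b.constr ℝ fun x => if (x : E) ∈ S then (0 : ℝ) else 1
  have hf : ∀ γ ∈ Δ, f γ = if γ ∈ S then 0 else 1 := fun γ hγ => by
    have hmem := hΔ.linearIndepOn.subset_extend (Set.subset_univ _) hγ
    have : b ⟨γ, hmem⟩ = γ := Module.Basis.extend_apply_self _ _
    conv_lhs => rw [← this]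
    rw [Module.Basis.constr_basis]
  refine ⟨LinearMap.toContinuousLinearMap f, fun γ hγ => ?_, fun γ hγ => ?_⟩ <;>
  · rw [LinearMap.coe_toContinuousLinearMap', hf γ hγ]
    split_ifs with h <;> simp [h]

/-- The edges of the zonotope at the vertex of `g` correspond to the simple roots. -/
theorem encard_edges [FiniteDimensional ℝ E] (hA : IsUnitRootSystem A) (hg : ∀ α ∈ A, g α ≠ 0)
    (hΔ : IsSimpleSystem A g Δ) :
    Set.encard {F : Set E | IsFace (t +ᵥ zonotope A) F ∧ dim F = 1 ∧ apex t A g ∈ F} =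
      Δ.card := by
  choose l hl hl0 using fun γ : E => hΔ.exists_functional {γ}
  have hfilter : ∀ γ ∈ Δ, {δ ∈ Δ | l γ δ = 0} = {γ} := fun γ hγ => by
    ext δ
    rw [Finset.mem_filter, Finset.mem_singleton]
    refine ⟨fun h => (hl0 γ δ h.1).1 h.2, ?_⟩
    rintro rfl
    exact ⟨hγ, (hl0 δ δ hγ).2 rfl⟩
  have himage : {F : Set E | IsFace (t +ᵥ zonotope A) F ∧ dim F = 1 ∧ apex t A g ∈ F} =
      (fun γ => maxFace t A (l γ)) '' (Δ : Set E) := by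
    ext F
    rw [Set.mem_ofPred_eq, isFace_vadd_zonotope_iff, Set.mem_image]
    constructor
    · rintro ⟨⟨m, rfl⟩, hdim, hv⟩
      rw [hA.apex_mem_maxFace_iff hg hΔ] at hv
      rw [dim_maxFace hA hg hΔ hv, Finset.card_eq_one] at hdim
      obtain ⟨γ, hγ⟩ := hdim
      have hγΔ : γ ∈ Δ :=
        (Finset.mem_filter.1 (hγ ▸ Finset.mem_singleton_self γ : γ ∈ {δ ∈ Δ | m δ = 0})).1
      refine ⟨γ, hγΔ, maxFace_eq_maxFace hA hg hΔ (hl γ) hv fun δ hδ => ?_⟩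
      have := congrArg (δ ∈ ·) ((hfilter γ hγΔ).trans hγ.symm)
      simpa [hδ] using this
    · rintro ⟨γ, hγ, rfl⟩
      refine ⟨⟨_, rfl⟩, ?_, (hA.apex_mem_maxFace_iff hg hΔ).2 (hl γ)⟩
      rw [dim_maxFace hA hg hΔ (hl γ), hfilter γ hγ, Finset.card_singleton]
  rw [himage, Set.InjOn.encard_image, Set.encard_coe_eq_coe_finsetCard]
  intro γ hγ δ hδ h
  have hspan := congrArg (vectorSpan ℝ) h
  simp only [vectorSpan_maxFace, span_filter hA hg hΔ (hl _), hfilter γ hγ, hfilter δ hδ]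
    at hspan
  by_contra hne
  refine hΔ.notMem_span (S := {δ}) hγ (by simpa using hδ) (by simpa using hne) ?_
  rw [← hspan]
  exact Submodule.subset_span (by simp)

/-- If the face of `m` corresponds to the simple roots `S` and the face of `l` to `S` together with
`j`, then the inward normal points opposite to the part of `j` orthogonal to `S`: the edges of the
zonotope at the vertex of `g` point along the negatives of the simple roots. -/
theorem isInwardUnitNormal [DecidableEq E] (hA : IsUnitRootSystem A) (hg : ∀ α ∈ A, g α ≠ 0)
    (hΔ : IsSimpleSystem A g Δ) {m : StrongDual ℝ E} (hm : ∀ γ ∈ Δ, 0 ≤ m γ)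
    (hl : ∀ γ ∈ Δ, 0 ≤ l γ) {j : E} {S : Finset E} (hmS : {γ ∈ Δ | m γ = 0} = S)
    (hlS : {γ ∈ Δ | l γ = 0} = insert j S) (hjS : j ∉ S) :
    IsInwardUnitNormal (maxFace t A m) (maxFace t A l)
      (‖perpPart S j‖⁻¹ • -perpPart S j) := by
  have hS : S ⊆ Δ := hmS ▸ Finset.filter_subset _ _
  have hj : j ∈ Δ :=
    (Finset.mem_filter.1 (hlS ▸ Finset.mem_insert_self j S : j ∈ {γ ∈ Δ | l γ = 0})).1
  have hp : 0 < ‖perpPart S j‖ := norm_pos_iff.2 (perpPart_ne_zero (hΔ.notMem_span hj hS hjS))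
  have hGspan : vectorSpan ℝ (maxFace t A m) = Submodule.span ℝ (S : Set E) := by
    rw [vectorSpan_maxFace, span_filter hA hg hΔ hm, hmS]
  refine ⟨?_, ?_, ?_, ?_⟩
  · rw [norm_smul, norm_neg, norm_inv, norm_norm, inv_mul_cancel₀ hp.ne']
  · rw [vectorSpan_maxFace, span_filter hA hg hΔ hl, hlS]
    refine Submodule.smul_mem _ _ (Submodule.neg_mem _ (Submodule.sub_mem _ ?_ ?_))
    · exact Submodule.subset_span (by simp)
    · exact Submodule.span_mono (by simp) (Submodule.starProjection_apply_mem _ j)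
  · rw [hGspan]
    exact Submodule.smul_mem _ _ (Submodule.neg_mem _ (perpPart_mem_orthogonal S j))
  · intro x hx y hy
    rw [inner_smul_left]
    refine mul_nonneg (inv_nonneg.2 hp.le) ?_
    rw [inner_neg_left, ← inner_neg_right, neg_sub]
    -- Moving `x` inside the face of `m` changes nothing, so it may be replaced by the vertex.
    have hv := (hA.apex_mem_maxFace_iff (t := t) hg hΔ).2 hm
    have hxv : inner ℝ (perpPart S j) (x - apex t A g) = (0 : ℝ) :=
      inner_perpPart_eq_zero (hGspan ▸ vsub_mem_vectorSpan ℝ hx hv)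
    rw [show x - y = (x - apex t A g) + (apex t A g - y) by abel, inner_add_right, hxv, zero_add]
    -- A positive root parallel to the face of `l` is a nonnegative combination of `j` and `S`.
    have hroot : ∀ α ∈ A, 0 < g α → l α = 0 → 0 ≤ (inner ℝ (perpPart S j) α : ℝ) := by
      intro α hα hgα hlα
      obtain ⟨c, hc, hαc⟩ := hΔ.exists_eq_sum_filter hl hα hgα hlα
      rw [hlS, Finset.sum_insert hjS] at hαc
      rw [hαc, inner_add_right, inner_smul_right, inner_perpPart_eq_zero
        (Submodule.sum_mem _ fun γ hγ => Submodule.smul_mem _ _ (Submodule.subset_span hγ)),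
        add_zero, real_inner_comm, ← inner_perpPart_perpPart]
      exact mul_nonneg (hc j hj) real_inner_self_nonneg
    obtain ⟨c, hc, hc1, hc0, rfl⟩ := mem_maxFace.1 hy
    rw [apex, add_sub_add_left_eq_sub, Finset.sum_filter, ← Finset.sum_sub_distrib, inner_sum]
    refine Finset.sum_nonneg fun α hα => ?_
    rcases (hg α hα).lt_or_gt with hgα | hgα
    · have hlα := (hA.apex_mem_maxFace_iff (t := t) hg hΔ).2 hl
      have hlα' := nonneg_of_apex_mem_maxFace hlα (hA.neg_mem hα) (by rw [map_neg]; linarith)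
      rw [map_neg, neg_nonneg] at hlα'
      rw [if_neg hgα.not_gt, zero_sub, ← smul_neg, inner_smul_right]
      rcases hlα'.lt_or_eq with h | h
      · rw [hc0 α hα h, zero_mul]
      · exact mul_nonneg (hc α hα).1
          (hroot _ (hA.neg_mem hα) (by rw [map_neg]; linarith) (by rw [map_neg, h, neg_zero]))
    · have hlα := nonneg_of_apex_mem_maxFace
        ((hA.apex_mem_maxFace_iff (t := t) hg hΔ).2 hl) hα hgα
      rw [if_pos hgα, show α - c α • α = (1 - c α) • α by rw [sub_smul, one_smul],
        inner_smul_right]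
      rcases hlα.lt_or_eq with h | h
      · rw [hc1 α hα h, sub_self, zero_mul]
      · exact mul_nonneg (sub_nonneg.2 (hc α hα).2) (hroot α hα hgα h.symm)

end IsSimpleSystem

/-- The dihedral angles of a root zonotope: at a vertex of the codimension two face there is a
simple system in which the two facets correspond to omitting one simple root each, and the
dihedral angle is the angle between the parts of these two roots orthogonal to the face. -/
theorem IsUnitRootSystem.exists_hasDihedralAngle [FiniteDimensional ℝ E] [DecidableEq E]
    (hA : IsUnitRootSystem A) {G F₁ F₂ : Set E} (h : FacetsMeetAt (t +ᵥ zonotope A) G F₁ F₂) :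
    ∃ (g : StrongDual ℝ E) (Δ S : Finset E) (i j : E), (∀ α ∈ A, g α ≠ 0) ∧
      IsSimpleSystem A g Δ ∧ insert i (insert j S) = Δ ∧ i ≠ j ∧ i ∉ S ∧ j ∉ S ∧
      HasDihedralAngle G F₁ F₂
        (InnerProductGeometry.angle (perpPart S i) (perpPart S j)) := by
  obtain ⟨hG, hGdim, ⟨hF₁, hdim₁, hGF₁⟩, ⟨hF₂, hdim₂, hGF₂⟩, hne⟩ := h
  rw [isFace_vadd_zonotope_iff] at hG hF₁ hF₂
  obtain ⟨m, rfl⟩ := hG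
  obtain ⟨l₁, rfl⟩ := hF₁
  obtain ⟨l₂, rfl⟩ := hF₂
  obtain ⟨g, hg, hv⟩ := exists_apex_mem_maxFace hA.ne_zero t m
  obtain ⟨Δ, hΔ⟩ := exists_isSimpleSystem hA hg
  have hl₁ := (hA.apex_mem_maxFace_iff hg hΔ).1 (hGF₁ hv)
  have hl₂ := (hA.apex_mem_maxFace_iff hg hΔ).1 (hGF₂ hv)
  have hm := (hA.apex_mem_maxFace_iff hg hΔ).1 hv
  rw [hΔ.dim_vadd_zonotope hA hg] at hGdim hdim₁ hdim₂
  rw [hΔ.dim_maxFace hA hg hm] at hGdim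
  rw [hΔ.dim_maxFace hA hg hl₁] at hdim₁
  rw [hΔ.dim_maxFace hA hg hl₂] at hdim₂
  set S : Finset E := {γ ∈ Δ | m γ = 0} with hS
  have hsub : ∀ l : StrongDual ℝ E, (∀ γ ∈ Δ, 0 ≤ l γ) →
      maxFace t A m ⊆ maxFace t A l → S ⊆ {γ ∈ Δ | l γ = 0} := by
    intro l hl hle γ hγ
    have hγΔ := (Finset.mem_filter.1 hγ).1
    by_contra hγl
    refine hΔ.notMem_span hγΔ (Finset.filter_subset _ _) hγl ?_
    rw [← hΔ.span_filter hA hg hl, ← vectorSpan_maxFace t]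
    refine vectorSpan_mono ℝ hle ?_
    rw [vectorSpan_maxFace, hΔ.span_filter hA hg hm]
    exact Submodule.subset_span hγ
  obtain ⟨i, hiS, hi⟩ := Finset.exists_eq_insert_iff.2
    ⟨hsub l₁ hl₁ hGF₁, (by omega : S.card + 1 = Finset.card {γ ∈ Δ | l₁ γ = 0})⟩
  obtain ⟨j, hjS, hj⟩ := Finset.exists_eq_insert_iff.2
    ⟨hsub l₂ hl₂ hGF₂, (by omega : S.card + 1 = Finset.card {γ ∈ Δ | l₂ γ = 0})⟩
  have hij : i ≠ j := by
    rintro rfl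
    refine hne (hΔ.maxFace_eq_maxFace hA hg hl₁ hl₂ fun γ hγ => ?_)
    have := congrArg (γ ∈ ·) (hi.symm.trans hj)
    simpa [hγ] using this
  have hΔS : insert i (insert j S) = Δ := by
    refine Finset.eq_of_subset_of_card_le (Finset.insert_subset ?_ ?_) ?_
    · exact (Finset.mem_filter.1 (hi ▸ Finset.mem_insert_self i S : i ∈ {γ ∈ Δ | l₁ γ = 0})).1
    · exact hj ▸ Finset.filter_subset _ _
    · rw [Finset.card_insert_of_notMem (by simp [hij, hiS]), Finset.card_insert_of_notMem hjS]
      omega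
  refine ⟨g, Δ, S, i, j, hg, hΔ, hΔS, hij, hiS, hjS, _, _,
    hΔ.isInwardUnitNormal hA hg hm hl₁ hS.symm hi.symm hiS,
    hΔ.isInwardUnitNormal hA hg hm hl₂ hS.symm hj.symm hjS, ?_⟩
  have hpos : ∀ k ∈ Δ, k ∉ S → 0 < ‖perpPart S k‖⁻¹ := fun k hk hkS =>
    inv_pos.2 (norm_pos_iff.2
      (perpPart_ne_zero (hΔ.notMem_span hk (Finset.filter_subset _ _) hkS)))
  rw [InnerProductGeometry.angle_smul_left_of_pos _ _ (hpos i (by simp [← hΔS]) hiS),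
    InnerProductGeometry.angle_smul_right_of_pos _ _ (hpos j (by simp [← hΔS]) hjS),
    InnerProductGeometry.angle_neg_neg]

theorem pi_div_two_le_angle {x y : E} (h : inner ℝ x y ≤ (0 : ℝ)) :
    Real.pi / 2 ≤ InnerProductGeometry.angle x y := by
  rw [InnerProductGeometry.angle, ← not_lt, Real.arccos_lt_pi_div_two, not_lt]
  exact div_nonpos_of_nonpos_of_nonneg h (by positivity)

theorem pi_div_two_lt_angle {x y : E} (h : inner ℝ x y < (0 : ℝ)) :
    Real.pi / 2 < InnerProductGeometry.angle x y := by
  refine lt_of_le_of_ne (pi_div_two_le_angle h.le) fun h' => h.ne ?_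
  exact (InnerProductGeometry.inner_eq_zero_iff_angle_eq_pi_div_two x y).2 h'.symm

theorem IsUnitRootSystem.isSimple_zonotope [FiniteDimensional ℝ E] (hA : IsUnitRootSystem A) :
    IsSimple (zonotope A) := by
  refine ⟨isPolytope_zonotope A, fun v hv => ?_⟩
  rw [← zero_vadd E (zonotope A)] at hv ⊢
  obtain ⟨l, hl⟩ := isFace_vadd_zonotope_iff.1 hv
  obtain ⟨g, hg, hgl⟩ := exists_apex_mem_maxFace hA.ne_zero 0 l
  obtain ⟨Δ, hΔ⟩ := exists_isSimpleSystem hA hg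
  rw [← hl, Set.mem_singleton_iff] at hgl
  rw [← hgl, hΔ.encard_edges hA hg, hΔ.dim_vadd_zonotope hA hg]

theorem IsUnitRootSystem.nonAcuteInCodimOne [FiniteDimensional ℝ E] (hA : IsUnitRootSystem A)
    (t : E) : NonAcuteInCodimOne (t +ᵥ zonotope A) := by
  classical
  intro G F₁ F₂ h
  obtain ⟨g, Δ, S, i, j, -, hΔ, rfl, hij, hiS, hjS, hangle⟩ := hA.exists_hasDihedralAngle h
  exact ⟨_, hangle, pi_div_two_le_angle (hΔ.inner_perpPart_nonpos
    (fun x hx => by simp [hx]) (by simp) (by simp) hij hiS hjS)⟩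

theorem IsUnitRootSystem.nonAcute_zonotope [FiniteDimensional ℝ E] (hA : IsUnitRootSystem A) :
    NonAcute (zonotope A) := by
  intro F hF
  rw [← zero_vadd E (zonotope A)] at hF
  obtain ⟨l, rfl⟩ := isFace_vadd_zonotope_iff.1 hF
  exact (hA.filter l).nonAcuteInCodimOne _

end Faces

/-! ### Reflection groups and orthogonal decompositions -/

section Decomposition

open Pointwise

variable {E : Type*} [NormedAddCommGroup E] [InnerProductSpace ℝ E]
  {W : Subgroup (E ≃ₗᵢ[ℝ] E)}

theorem hyperplaneReflection_smul {r : ℝ} (hr : r ≠ 0) (α : E) :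
    hyperplaneReflection (r • α) = hyperplaneReflection α := by
  unfold hyperplaneReflection
  congr 2
  exact Submodule.span_singleton_smul_eq (IsUnit.mk0 r hr) α

theorem hyperplaneReflection_map (w : E ≃ₗᵢ[ℝ] E) {β : E} (hβ : ‖β‖ = 1) :
    hyperplaneReflection (w β) = w * hyperplaneReflection β * w⁻¹ := by
  ext x
  have hw : w (w⁻¹ x) = x := w.apply_symm_apply x
  have hx : inner ℝ (w β) x = (inner ℝ β (w⁻¹ x) : ℝ) := by
    rw [← w.inner_map_map β, hw]
  rw [hyperplaneReflection_apply _ _ (by rw [w.norm_map, hβ]), LinearIsometryEquiv.coe_mul,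
    LinearIsometryEquiv.coe_mul, Function.comp_apply, Function.comp_apply,
    hyperplaneReflection_apply _ _ hβ, map_sub, map_smul, hx, hw]

theorem hyperplaneReflection_eq_self {α x : E} (hα : ‖α‖ = 1) (h : inner ℝ α x = (0 : ℝ)) :
    hyperplaneReflection α x = x := by
  rw [hyperplaneReflection_apply α x hα, h, mul_zero, zero_smul, sub_zero]

theorem hyperplaneReflection_ne_one {α : E} (hα : α ≠ 0) : hyperplaneReflection α ≠ 1 :=
  fun h => hα <| by
    have h1 := hyperplaneReflection_self α
    rw [h, LinearIsometryEquiv.coe_one, id] at h1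
    have h2 : (2 : ℝ) • α = 0 := by
      rw [two_smul]
      nth_rewrite 2 [h1]
      exact add_neg_cancel α
    exact (smul_eq_zero.1 h2).resolve_left two_ne_zero

theorem isUnitRootSystem_unitRoots (W : Subgroup (E ≃ₗᵢ[ℝ] E)) [Finite W] :
    IsUnitRootSystem (unitRoots_finite W).toFinset := by
  refine ⟨fun α hα => ((Set.Finite.mem_toFinset _).1 hα).1, fun α hα β hβ => ?_⟩
  rw [Set.Finite.mem_toFinset] at *
  rw [← hyperplaneReflection_apply α β hα.1]
  refine ⟨by rw [LinearIsometryEquiv.norm_map, hβ.1], ?_⟩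
  rw [hyperplaneReflection_map _ hβ.1]
  exact W.mul_mem (W.mul_mem hα.2 hβ.2) (W.inv_mem hα.2)

/-- The subgroup generated by the reflections of `W` whose roots lie in `U`. -/
def reflectionSubgroup (W : Subgroup (E ≃ₗᵢ[ℝ] E)) (U : Submodule ℝ E) :
    Subgroup (E ≃ₗᵢ[ℝ] E) :=
  Subgroup.closure (hyperplaneReflection '' {α | α ∈ unitRoots W ∧ α ∈ U})

theorem hyperplaneReflection_mem_reflectionSubgroup {U : Submodule ℝ E} {α : E}
    (hα : α ∈ unitRoots W) (hU : α ∈ U) :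
    hyperplaneReflection α ∈ reflectionSubgroup W U :=
  Subgroup.subset_closure ⟨α, ⟨hα, hU⟩, rfl⟩

theorem ne_zero_of_mem_unitRoots {α : E} (hα : α ∈ unitRoots W) : α ≠ 0 := fun h => by
  simpa [h] using hα.1

theorem generatedByReflections_reflectionSubgroup (W : Subgroup (E ≃ₗᵢ[ℝ] E))
    (U : Submodule ℝ E) : GeneratedByReflections (reflectionSubgroup W U) := by
  refine le_antisymm ((Subgroup.closure_le _).2 fun s hs => hs.1) ((Subgroup.closure_le _).2 ?_)
  rintro _ ⟨α, hα, rfl⟩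
  exact Subgroup.subset_closure ⟨hyperplaneReflection_mem_reflectionSubgroup hα.1 hα.2,
    α, ne_zero_of_mem_unitRoots hα.1, rfl⟩

theorem apply_eq_self_of_mem_reflectionSubgroup {U : Submodule ℝ E} {w : E ≃ₗᵢ[ℝ] E}
    (hw : w ∈ reflectionSubgroup W U) {x : E} (hx : ∀ u ∈ U, inner ℝ u x = (0 : ℝ)) :
    w x = x := by
  induction hw using Subgroup.closure_induction with
  | mem s hs =>
    obtain ⟨α, hα, rfl⟩ := hs
    exact hyperplaneReflection_eq_self hα.1.1 (hx α hα.2)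
  | one => rfl
  | mul a b _ _ ha hb => rw [LinearIsometryEquiv.coe_mul, Function.comp_apply, hb, ha]
  | inv a _ ha =>
    conv_lhs => rw [← ha]
    exact a.symm_apply_apply x

theorem commute_of_mem_reflectionSubgroup {U V : Submodule ℝ E} (hUV : U ⟂ V)
    {a b : E ≃ₗᵢ[ℝ] E} (ha : a ∈ reflectionSubgroup W U) (hb : b ∈ reflectionSubgroup W V) :
    Commute a b := by
  induction ha using Subgroup.closure_induction with
  | mem s hs =>
    obtain ⟨α, hα, rfl⟩ := hs
    -- `b` fixes `α`, hence commutes with its reflection.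
    have h : b α = α := apply_eq_self_of_mem_reflectionSubgroup hb fun v hv =>
      Submodule.isOrtho_iff_inner_eq.1 hUV.symm v hv α hα.2
    have h2 := hyperplaneReflection_map b hα.1.1
    rw [h] at h2
    exact eq_mul_inv_iff_mul_eq.1 h2
  | one => exact Commute.one_left b
  | mul _ _ _ _ h1 h2 => exact h1.mul_left h2
  | inv _ _ h => exact h.inv_left

/-- If the roots of an irreducible group split into two orthogonal parts, one part is empty. -/
theorem IsIrreducible.not_split [FiniteDimensional ℝ E] (hirr : IsIrreducible W)
    (hW : GeneratedByReflections W) {U V : Submodule ℝ E} (hUV : U ⟂ V)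
    (hsplit : ∀ α ∈ unitRoots W, α ∈ U ∨ α ∈ V) {α β : E} (hα : α ∈ unitRoots W)
    (hαU : α ∈ U) (hβ : β ∈ unitRoots W) (hβV : β ∈ V) : False := by
  have hle : ∀ U : Submodule ℝ E, reflectionSubgroup W U ≤ W := fun U =>
    (Subgroup.closure_le _).2 fun _ ⟨_, hα, h⟩ => h ▸ hα.1.2
  have hinf : reflectionSubgroup W U ⊓ reflectionSubgroup W V = ⊥ := by
    refine (Subgroup.eq_bot_iff_forall _).2 fun w ⟨hwU, hwV⟩ => ?_
    ext x
    obtain ⟨u, hu, v, hv, rfl⟩ := U.exists_add_mem_mem_orthogonal x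
    rw [map_add, LinearIsometryEquiv.coe_one, id,
      apply_eq_self_of_mem_reflectionSubgroup hwU fun y hy =>
        Submodule.inner_right_of_mem_orthogonal hy hv,
      apply_eq_self_of_mem_reflectionSubgroup hwV fun y hy =>
        Submodule.isOrtho_iff_inner_eq.1 hUV.symm y hy u hu]
  have hsup : reflectionSubgroup W U ⊔ reflectionSubgroup W V = W := by
    refine le_antisymm (sup_le (hle U) (hle V)) ?_
    conv_lhs => rw [← hW]
    refine (Subgroup.closure_le _).2 ?_
    rintro _ ⟨hs, γ, hγ, rfl⟩
    have hγ' : ‖γ‖⁻¹ ≠ 0 := inv_ne_zero (norm_ne_zero_iff.2 hγ)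
    rw [← hyperplaneReflection_smul hγ'] at hs ⊢
    have hroot : ‖γ‖⁻¹ • γ ∈ unitRoots W :=
      ⟨by rw [norm_smul, norm_inv, norm_norm, inv_mul_cancel₀ (norm_ne_zero_iff.2 hγ)], hs⟩
    rcases hsplit _ hroot with h | h
    · exact (le_sup_left : _ ≤ reflectionSubgroup W U ⊔ reflectionSubgroup W V)
        (hyperplaneReflection_mem_reflectionSubgroup hroot h)
    · exact (le_sup_right : _ ≤ reflectionSubgroup W U ⊔ reflectionSubgroup W V)
        (hyperplaneReflection_mem_reflectionSubgroup hroot h)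
  rcases hirr.2 _ _ (generatedByReflections_reflectionSubgroup W U)
    (generatedByReflections_reflectionSubgroup W V)
    (fun a ha b hb => commute_of_mem_reflectionSubgroup hUV ha hb) hinf hsup with h | h
  · have := hyperplaneReflection_mem_reflectionSubgroup hα hαU
    rw [h, Subgroup.mem_bot] at this
    exact hyperplaneReflection_ne_one (ne_zero_of_mem_unitRoots hα) this
  · have := hyperplaneReflection_mem_reflectionSubgroup hβ hβV
    rw [h, Subgroup.mem_bot] at this
    exact hyperplaneReflection_ne_one (ne_zero_of_mem_unitRoots hβ) this

theorem IsIrreducible.obtuseInCodimOne [FiniteDimensional ℝ E] [Finite W]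
    (hirr : IsIrreducible W) (hW : GeneratedByReflections W) :
    ObtuseInCodimOne (coxeterZonotope W) := by
  classical
  intro G F₁ F₂ h
  have hA := isUnitRootSystem_unitRoots W
  rw [coxeterZonotope, ← zero_vadd E (zonotope _)] at h
  obtain ⟨g, Δ, S, i, j, hg, hΔ, hΔS, hij, hiS, hjS, hangle⟩ := hA.exists_hasDihedralAngle h
  have hi : i ∈ Δ := by simp [← hΔS]
  have hj : j ∈ Δ := by simp [← hΔS]
  refine ⟨_, hangle, pi_div_two_lt_angle (lt_of_le_of_ne (hΔ.inner_perpPart_nonpos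
    (fun x hx => by simp [← hΔS, hx]) hi hj hij hiS hjS) fun h0 => ?_)⟩
  obtain ⟨D, -, hjD, hiD, hD⟩ :=
    hΔ.exists_split_of_inner_perpPart_eq_zero hΔS hij hiS hjS h0
  refine hirr.not_split hW (Submodule.isOrtho_span.2 fun x hx y hy => hD x hx y hy)
    (fun α hα => hΔ.mem_span_or_mem_span hA hg hD ((Set.Finite.mem_toFinset _).2 hα))
    ((Set.Finite.mem_toFinset _).1 (hΔ.subset hj)) (Submodule.subset_span hjD)
    ((Set.Finite.mem_toFinset _).1 (hΔ.subset hi)) (Submodule.subset_span ?_)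
  exact Finset.mem_coe.2 (Finset.mem_sdiff.2 ⟨hi, hiD⟩)

end Decomposition

end CoxeterZonotope

theorem mainTheorem9 {E : Type*} [NormedAddCommGroup E] [InnerProductSpace ℝ E]
    [FiniteDimensional ℝ E] (W : Subgroup (E ≃ₗᵢ[ℝ] E)) [Finite W]
    (hW : CoxeterZonotope.GeneratedByReflections W) :
    CoxeterZonotope.IsSimple (CoxeterZonotope.coxeterZonotope W) ∧
    CoxeterZonotope.NonAcute (CoxeterZonotope.coxeterZonotope W) ∧
    (CoxeterZonotope.IsIrreducible W →
      CoxeterZonotope.ObtuseInCodimOne (CoxeterZonotope.coxeterZonotope W)) :=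
  ⟨(CoxeterZonotope.isUnitRootSystem_unitRoots W).isSimple_zonotope,
    (CoxeterZonotope.isUnitRootSystem_unitRoots W).nonAcute_zonotope,
    fun hirr => hirr.obtuseInCodimOne hW⟩
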